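/- Let $H\in(\tfrac12,1)$, $\sigma>0$, and let $\xi_1,\xi_2,\dots$ be i.i.d. random variables with $P(\xi_1=1)=P(\xi_1=-1)=\tfrac12$. Put $h=\tfrac H2+\tfrac14\in(\tfrac12,\tfrac34)$, $$c_H=\sqrt{\frac{2H\,\Gamma(\frac32-H)}{\Gamma(H+\frac12)\,\Gamma(2-2H)}},\qquad g_H=\frac{\sigma c_H}{H+\frac12},\qquad \rho_h(k)=\tfrac12\big((k+1)^{2h}+(k-1)^{2h}-2k^{2h}\big)\quad(k\ge1).$$ Then the series $$\mathcal Y_H=2g_H\sum_{k=1}^\infty\rho_h(k)\,\xi_k$$ converges almost surely. The law of $\mathcal Y_H$ is absolutely continuous with respect to Lebesgue measure on $\mathbb R$, and it has a density $f_H$ that is symmetric ($f_H(-x)=f_H(x)$), bounded and square-integrable, and whose support is not compact (there is no compact set outside of which $f_H$ vanishes almost everywhere). Moreover, for every $v\in\mathbb R$, $$E\big[e^{iv\mathcal Y_H}\big]=\prod_{k=1}^\infty\cos\big(2v\,g_H\,\rho_h(k)\big),$$ and this characteristic function decays faster than exponentially: there are constants $\theta_H>0$ and $u_H\in\mathbb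 R$, depending only on $H$, such that $$\big|E[e^{iv\mathcal Y_H}]\big|\le \exp\!\big(-\theta_H\,(2g_H|v|)^{1/(2-2h)}\big)\qquad\text{for all } v \text{ with } 2g_H|v|\ge u_H,$$ where $1/(2-2h)=1/(\tfrac32-H)>1$. -/

import Mathlib

open MeasureTheory ProbabilityTheory Filter Topology

noncomputable section

namespace FracBinary

/-- The normalizing constant `c_H`. -/
def cH (H : ℝ) : ℝ :=
  Real.sqrt (2 * H * Real.Gamma (3 / 2 - H) / (Real.Gamma (H + 1 / 2) * Real.Gamma (2 - 2 * H)))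

/-- The constant `g_H = σ c_H / (H + 1/2)`. -/
def gH (σ H : ℝ) : ℝ := σ * cH H / (H + 1 / 2)

/-- The parameter `h = H/2 + 1/4`. -/
def hOf (H : ℝ) : ℝ := H / 2 + 1 / 4

/-- `ρ_h(k) = ((k+1)^{2h} + (k-1)^{2h} - 2 k^{2h}) / 2`, used for `k ≥ 1`. -/
def rho (h : ℝ) (k : ℕ) : ℝ :=
  1 / 2 * (((k : ℝ) + 1) ^ (2 * h) + ((k : ℝ) - 1) ^ (2 * h) - 2 * (k : ℝ) ^ (2 * h))

/-- The partial sum `2 g_H ∑_{k=1}^{n} ρ_h(k) ξ_k`, where the sequence `ξ_1, ξ_2, …` is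
written `ξ 0, ξ 1, …`, that is, `ξ k` stands for `ξ_{k+1}`. -/
def partialY {Ω : Type*} (σ H : ℝ) (ξ : ℕ → Ω → ℝ) (n : ℕ) (ω : Ω) : ℝ :=
  2 * gH σ H * ∑ k ∈ Finset.range n, rho (hOf H) (k + 1) * ξ k ω

/-- The random variable `𝒴_H = 2 g_H ∑_{k=1}^{∞} ρ_h(k) ξ_k`: the limit of the partial sums
(with an arbitrary value at those `ω` where they do not converge). -/
def YH {Ω : Type*} (σ H : ℝ) (ξ : ℕ → Ω → ℝ) (ω : Ω) : ℝ :=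
  limUnder atTop (fun n => partialY σ H ξ n ω)

/-- `ξ` is a sequence of i.i.d. random signs: `P(ξ_k = 1) = P(ξ_k = -1) = 1/2`. -/
structure IsSignSequence {Ω : Type*} [MeasurableSpace Ω] (P : Measure Ω)
    (ξ : ℕ → Ω → ℝ) : Prop where
  measurable : ∀ k, Measurable (ξ k)
  indep : iIndepFun ξ P
  prob_one : ∀ k, P {ω | ξ k ω = 1} = 1 / 2
  prob_neg_one : ∀ k, P {ω | ξ k ω = -1} = 1 / 2

end FracBinary

end

/-! Put α = 2 - 2h, which lies in (1/2, 1). Two applications of the mean value theorem show that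
ρ_h(k) is comparable to k^(-α), and everything rests on this size. Since 2α > 1, the coefficients
are square-summable. The partial sums then form an L²-bounded martingale, which converges almost
surely, and dominated convergence turns the finite products of cosines into the characteristic
function of the limit. Since α < 1, the coefficients themselves have infinite sum. Flipping finitely
many signs preserves the law but moves the limit by an arbitrarily large amount with positive
probability, so the limit is unbounded (`not_ae_abs_le`). For the decay, set w = 2 g_H |v|. About
w^(1/α) indices k have w ρ_h(k) in a fixed interval on which the cosine stays below a constant less
than 1; all other factors are at most 1 in modulus (`exists_decay`). Only h enters, so θ and the
threshold do not depend on σ. The decay makes the characteristic function integrable. Testing the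
law against Gaussian bumps then bounds the mass of a ball by a multiple of its radius, and a
covering theorem extends this to all sets. The density is therefore bounded, hence
square-integrable. -/

namespace FracBinary

/-! ### Random series with independent signs -/

namespace IsSignSequence

variable {Ω : Type*} [MeasurableSpace Ω] {P : Measure Ω} {ξ : ℕ → Ω → ℝ}

lemma indep_const_mul (hξ : IsSignSequence P ξ) (a : ℕ → ℝ) :
    iIndepFun (fun k ω => a k * ξ k ω) P :=
  hξ.indep.comp (fun k x => a k * x) fun k => measurable_const_mul (a k)

lemma mul_signs (hξ : IsSignSequence P ξ) {ε : ℕ → ℝ} (hε : ∀ k, ε k = 1 ∨ ε k = -1) :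
    IsSignSequence P (fun k ω => ε k * ξ k ω) where
  measurable k := (hξ.measurable k).const_mul _
  indep := hξ.indep_const_mul ε
  prob_one k := by
    rcases hε k with h | h
    · simpa [h] using hξ.prob_one k
    · simpa [h, neg_eq_iff_eq_neg] using hξ.prob_neg_one k
  prob_neg_one k := by
    rcases hε k with h | h
    · simpa [h] using hξ.prob_neg_one k
    · simpa [h] using hξ.prob_one k

variable [IsProbabilityMeasure P]

lemma ae_eq_one_or_neg_one (hξ : IsSignSequence P ξ) (k : ℕ) :
    ∀ᵐ ω ∂P, ξ k ω = 1 ∨ ξ k ω = -1 := by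
  have h1 : MeasurableSet {ω | ξ k ω = 1} := hξ.measurable k (measurableSet_singleton 1)
  have h2 : MeasurableSet {ω | ξ k ω = -1} := hξ.measurable k (measurableSet_singleton (-1))
  have hd : Disjoint {ω | ξ k ω = 1} {ω | ξ k ω = -1} := by
    rw [Set.disjoint_left]
    intro ω h h'
    simp only [Set.mem_ofPred_eq] at h h'
    norm_num [h] at h'
  have hu : P ({ω | ξ k ω = 1} ∪ {ω | ξ k ω = -1}) = 1 := by
    rw [measure_union hd h2, hξ.prob_one, hξ.prob_neg_one, ENNReal.add_halves]
  exact (prob_compl_eq_zero_iff (h1.union h2)).2 hu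

lemma ae_abs_eq_one (hξ : IsSignSequence P ξ) (k : ℕ) : ∀ᵐ ω ∂P, |ξ k ω| = 1 := by
  filter_upwards [hξ.ae_eq_one_or_neg_one k] with ω h
  rcases h with h | h <;> simp [h]

lemma integral_comp {E : Type*} [NormedAddCommGroup E] [NormedSpace ℝ E] [CompleteSpace E]
    (hξ : IsSignSequence P ξ) (k : ℕ) (g : ℝ → E) :
    ∫ ω, g (ξ k ω) ∂P = (1 / 2 : ℝ) • g 1 + (1 / 2 : ℝ) • g (-1) := by
  have h1 : MeasurableSet {ω | ξ k ω = 1} := hξ.measurable k (measurableSet_singleton 1)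
  have h2 : MeasurableSet {ω | ξ k ω = -1} := hξ.measurable k (measurableSet_singleton (-1))
  have h : (fun ω => g (ξ k ω)) =ᵐ[P] fun ω => {ω | ξ k ω = 1}.indicator (fun _ => g 1) ω +
      {ω | ξ k ω = -1}.indicator (fun _ => g (-1)) ω := by
    filter_upwards [hξ.ae_eq_one_or_neg_one k] with ω h
    rcases h with h | h <;> norm_num [h, Set.indicator]
  rw [integral_congr_ae h, integral_add ((integrable_const _).indicator h1)
    ((integrable_const _).indicator h2), integral_indicator_const _ h1,
    integral_indicator_const _ h2]
  simp [measureReal_def, hξ.prob_one, hξ.prob_neg_one]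

lemma memLp_const_mul (hξ : IsSignSequence P ξ) (c : ℝ) (k : ℕ) (p : ENNReal) :
    MemLp (fun ω => c * ξ k ω) p P :=
  MemLp.of_bound ((hξ.measurable k).const_mul c).aestronglyMeasurable |c| (by
    filter_upwards [hξ.ae_abs_eq_one k] with ω h
    simp [h])

lemma integral_const_mul (hξ : IsSignSequence P ξ) (c : ℝ) (k : ℕ) :
    ∫ ω, c * ξ k ω ∂P = 0 := by
  rw [hξ.integral_comp k (fun x => c * x)]
  simp

lemma variance_const_mul (hξ : IsSignSequence P ξ) (c : ℝ) (k : ℕ) :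
    variance (fun ω => c * ξ k ω) P = c ^ 2 := by
  rw [variance_of_integral_eq_zero ((hξ.measurable k).const_mul c).aemeasurable
    (hξ.integral_const_mul c k), hξ.integral_comp k (fun x => (c * x) ^ 2)]
  simp
  ring

lemma charFun_const_mul (hξ : IsSignSequence P ξ) (c : ℝ) (k : ℕ) (v : ℝ) :
    charFun (P.map (fun ω => c * ξ k ω)) v = (Real.cos (v * c) : ℂ) := by
  rw [charFun_apply_real, integral_map ((hξ.measurable k).const_mul c).aemeasurable (by fun_prop),
    hξ.integral_comp k (fun x => Complex.exp (v * ((c * x : ℝ) : ℂ) * Complex.I))]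
  push_cast
  rw [Complex.cos]
  simp only [Complex.real_smul]
  push_cast
  ring_nf

lemma charFun_sum (hξ : IsSignSequence P ξ) (a : ℕ → ℝ) (n : ℕ) (v : ℝ) :
    charFun (P.map (fun ω => ∑ k ∈ Finset.range n, a k * ξ k ω)) v =
      ∏ k ∈ Finset.range n, (Real.cos (v * a k) : ℂ) := by
  rw [iIndepFun.charFun_map_fun_finsetSum_eq_prod (X := fun k ω => a k * ξ k ω)
    (fun k _ => ((hξ.measurable k).const_mul (a k)).aemeasurable)
    ((hξ.indep_const_mul a).restrict _), Finset.prod_apply]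
  exact Finset.prod_congr rfl fun k _ => hξ.charFun_const_mul (a k) k v

lemma integral_sq_sum (hξ : IsSignSequence P ξ) (a : ℕ → ℝ) (n : ℕ) :
    ∫ ω, (∑ k ∈ Finset.range n, a k * ξ k ω) ^ 2 ∂P = ∑ k ∈ Finset.range n, a k ^ 2 := by
  have h := IndepFun.variance_sum (X := fun k ω => a k * ξ k ω) (s := Finset.range n)
    (fun k _ => hξ.memLp_const_mul (a k) k 2)
    (fun i _ j _ hij => (hξ.indep_const_mul a).indepFun hij)
  simp_rw [hξ.variance_const_mul] at h
  rw [← h, variance_of_integral_eq_zero]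
  · simp
  · exact Finset.aemeasurable_sum _ fun k _ => ((hξ.measurable k).const_mul (a k)).aemeasurable
  · simp only [Finset.sum_apply]
    rw [integral_finsetSum _ fun k _ => (hξ.memLp_const_mul (a k) k 1).integrable le_rfl]
    exact Finset.sum_eq_zero fun k _ => hξ.integral_const_mul (a k) k

/-- The martingale convergence theorem needs an L¹ bound; |s| ≤ 1 + s² reduces it to the second
moments, which add up by independence. -/
lemma exists_ae_tendsto_sum (hξ : IsSignSequence P ξ) {a : ℕ → ℝ}
    (ha : Summable fun k => a k ^ 2) :
    ∀ᵐ ω ∂P, ∃ c, Tendsto (fun n => ∑ k ∈ Finset.range n, a k * ξ k ω) atTop (𝓝 c) := by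
  set X : ℕ → Ω → ℝ := fun k ω => a k * ξ k ω with hX
  have hXm (k : ℕ) : StronglyMeasurable (X k) :=
    ((hξ.measurable k).const_mul (a k)).stronglyMeasurable
  have hXi (k : ℕ) : Integrable (X k) P := (hξ.memLp_const_mul (a k) k 1).integrable le_rfl
  have hS2 (n : ℕ) : MemLp (fun ω => ∑ k ∈ Finset.range n, X k ω) 2 P :=
    memLp_finsetSum _ fun k _ => hξ.memLp_const_mul (a k) k 2
  -- The sum runs up to index n included, so that `S n` is measurable at time n of the natural
  -- filtration.
  let S : ℕ → Ω → ℝ := fun n ω => ∑ k ∈ Finset.range (n + 1), X k ω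
  have hSi (n : ℕ) : Integrable (S n) P := integrable_finsetSum _ fun k _ => hXi k
  have hmart : Martingale S (Filtration.natural X hXm) P := by
    refine martingale_of_condExp_sub_eq_zero_nat (fun n => ?_) hSi fun n => ?_
    · exact Finset.stronglyMeasurable_fun_sum _ fun k hk =>
        ((Filtration.stronglyAdapted_natural hXm) k).mono
          ((Filtration.natural X hXm).mono (Nat.lt_succ_iff.1 (Finset.mem_range.1 hk)))
    · have hsub : S (n + 1) - S n = X (n + 1) := by
        ext ω
        simp [S, Finset.sum_range_succ _ (n + 1)]
      rw [hsub]
      refine (iIndepFun.condExp_natural_ae_eq_of_lt hXm (hξ.indep_const_mul a)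
        (Nat.lt_succ_self n)).trans ?_
      simp only [hX, hξ.integral_const_mul]
      rfl
  have hbdd (n : ℕ) : eLpNorm (S n) 1 P ≤ ((1 + ∑' k, a k ^ 2).toNNReal : ENNReal) := by
    rw [eLpNorm_one_eq_lintegral_enorm, ← ofReal_integral_norm_eq_lintegral_enorm (hSi n)]
    refine ENNReal.ofReal_le_ofReal ?_
    calc ∫ ω, ‖S n ω‖ ∂P ≤ ∫ ω, (1 + S n ω ^ 2) ∂P := by
          refine integral_mono (hSi n).norm
            ((integrable_const _).add (hS2 (n + 1)).integrable_sq) fun ω => ?_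
          simp only [Real.norm_eq_abs]
          nlinarith [sq_nonneg (|S n ω| - 1), sq_abs (S n ω), sq_nonneg (S n ω)]
      _ = 1 + ∑ k ∈ Finset.range (n + 1), a k ^ 2 := by
          rw [integral_add (integrable_const _) (hS2 (n + 1)).integrable_sq,
            hξ.integral_sq_sum a (n + 1)]
          simp
      _ ≤ 1 + ∑' k, a k ^ 2 := by
          gcongr
          exact ha.sum_le_tsum _ fun k _ => sq_nonneg _
  filter_upwards [hmart.submartingale.exists_ae_tendsto_of_bdd hbdd] with ω ⟨c, hc⟩
  exact ⟨c, (tendsto_add_atTop_iff_nat 1).1 hc⟩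

/-- The factors differ from 1 by at most b_k² / 2. -/
lemma multipliable_cos {b : ℕ → ℝ} (hb : Summable fun k => b k ^ 2) :
    Multipliable fun k => (Real.cos (b k) : ℂ) := by
  have h : Multipliable fun k => (1 + ((Real.cos (b k) : ℂ) - 1)) := by
    refine multipliable_one_add_of_summable ((hb.div_const 2).of_nonneg_of_le
      (fun _ => norm_nonneg _) fun k => ?_)
    rw [← Complex.ofReal_one, ← Complex.ofReal_sub, Complex.norm_real, Real.norm_eq_abs,
      abs_sub_comm, abs_of_nonneg (by linarith [Real.cos_le_one (b k)])]
    linarith [Real.one_sub_sq_div_two_le_cos (x := b k)]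
  simpa using h

/-- The characteristic function of a random series with signs is the product of cosines. -/
lemma hasProd_charFun (hξ : IsSignSequence P ξ) {a : ℕ → ℝ} (ha : Summable fun k => a k ^ 2)
    {Y : Ω → ℝ} (hYm : AEMeasurable Y P)
    (hY : ∀ᵐ ω ∂P, Tendsto (fun n => ∑ k ∈ Finset.range n, a k * ξ k ω) atTop (𝓝 (Y ω)))
    (v : ℝ) :
    HasProd (fun k => (Real.cos (v * a k) : ℂ)) (charFun (P.map Y) v) := by
  have hm : Multipliable fun k => (Real.cos (v * a k) : ℂ) :=
    multipliable_cos (by simpa only [mul_pow] using ha.mul_left (v ^ 2))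
  have hlim : Tendsto (fun n => charFun (P.map
      (fun ω => ∑ k ∈ Finset.range n, a k * ξ k ω)) v) atTop (𝓝 (charFun (P.map Y) v)) := by
    have hSm (n : ℕ) : Measurable fun ω => ∑ k ∈ Finset.range n, a k * ξ k ω :=
      Finset.measurable_sum _ fun k _ => (hξ.measurable k).const_mul (a k)
    have hch {Z : Ω → ℝ} (hZ : AEMeasurable Z P) :
        charFun (P.map Z) v = ∫ ω, Complex.exp (v * Z ω * Complex.I) ∂P := by
      rw [charFun_apply_real, integral_map hZ (by fun_prop)]
    rw [hch hYm]
    simp_rw [fun n => hch (hSm n).aemeasurable]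
    refine tendsto_integral_of_dominated_convergence (fun _ => 1) (fun n => ?_)
      (integrable_const _) (fun n => ?_) ?_
    · exact (Measurable.comp (g := fun x : ℝ => Complex.exp (v * x * Complex.I)) (by fun_prop)
        (hSm n)).aestronglyMeasurable
    · refine ae_of_all _ fun ω => ?_
      rw [← Complex.ofReal_mul, Complex.norm_exp_ofReal_mul_I]
    · filter_upwards [hY] with ω h
      exact ((by fun_prop : Continuous fun x : ℝ => Complex.exp (v * x * Complex.I)).tendsto
        (Y ω)).comp h
  simp_rw [hξ.charFun_sum a] at hlim
  rw [tendsto_nhds_unique hlim hm.hasProd.tendsto_prod_nat]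
  exact hm.hasProd

/-- Two random series with the same coefficients have the same law. -/
lemma map_eq_map {ξ' : ℕ → Ω → ℝ} (hξ : IsSignSequence P ξ) (hξ' : IsSignSequence P ξ')
    {a : ℕ → ℝ} (ha : Summable fun k => a k ^ 2) {Y Y' : Ω → ℝ}
    (hYm : AEMeasurable Y P) (hYm' : AEMeasurable Y' P)
    (hY : ∀ᵐ ω ∂P, Tendsto (fun n => ∑ k ∈ Finset.range n, a k * ξ k ω) atTop (𝓝 (Y ω)))
    (hY' : ∀ᵐ ω ∂P, Tendsto (fun n => ∑ k ∈ Finset.range n, a k * ξ' k ω) atTop (𝓝 (Y' ω))) :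
    P.map Y = P.map Y' := by
  have := Measure.isProbabilityMeasure_map hYm
  have := Measure.isProbabilityMeasure_map hYm'
  refine Measure.ext_of_charFun (funext fun v => ?_)
  exact (hξ.hasProd_charFun ha hYm hY v).unique (hξ'.hasProd_charFun ha hYm' hY' v)

/-- The law of a random series with signs is symmetric. -/
lemma map_neg_eq (hξ : IsSignSequence P ξ) {a : ℕ → ℝ} (ha : Summable fun k => a k ^ 2)
    {Y : Ω → ℝ} (hYm : AEMeasurable Y P)
    (hY : ∀ᵐ ω ∂P, Tendsto (fun n => ∑ k ∈ Finset.range n, a k * ξ k ω) atTop (𝓝 (Y ω))) :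
    P.map (fun ω => -Y ω) = P.map Y := by
  refine (hξ.mul_signs (ε := fun _ => -1) fun _ => Or.inr rfl).map_eq_map hξ ha hYm.neg hYm ?_ hY
  filter_upwards [hY] with ω h
  simpa using h.neg

/-- A random series with signs whose coefficients are not summable is not bounded. -/
lemma not_ae_abs_le (hξ : IsSignSequence P ξ) {a : ℕ → ℝ} (ha : Summable fun k => a k ^ 2)
    (hdiv : Tendsto (fun n => ∑ k ∈ Finset.range n, a k) atTop atTop)
    {Y : Ω → ℝ} (hYm : AEMeasurable Y P)
    (hY : ∀ᵐ ω ∂P, Tendsto (fun n => ∑ k ∈ Finset.range n, a k * ξ k ω) atTop (𝓝 (Y ω)))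
    (R : ℝ) : ¬ ∀ᵐ ω ∂P, |Y ω| ≤ R := by
  intro hR
  obtain ⟨n, hn⟩ := (hdiv.eventually_gt_atTop R).exists
  -- Flipping the first n signs replaces Y by Y - 2 S_n without changing its law, so the bound R
  -- holds for both.
  let ε : ℕ → ℝ := fun k => if k < n then -1 else 1
  have hε (k : ℕ) : ε k = 1 ∨ ε k = -1 := by by_cases h : k < n <;> simp [ε, h]
  have hSm : Measurable fun ω => ∑ k ∈ Finset.range n, a k * ξ k ω :=
    Finset.measurable_sum _ fun k _ => (hξ.measurable k).const_mul (a k)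
  let Y' : Ω → ℝ := fun ω => Y ω - 2 * ∑ k ∈ Finset.range n, a k * ξ k ω
  have hYm' : AEMeasurable Y' P := hYm.sub (hSm.const_mul 2).aemeasurable
  have hlaw : P.map Y = P.map Y' := by
    refine hξ.map_eq_map (hξ.mul_signs hε) ha hYm hYm' hY ?_
    filter_upwards [hY] with ω h
    refine (h.sub_const (2 * ∑ k ∈ Finset.range n, a k * ξ k ω)).congr' ?_
    filter_upwards [eventually_ge_atTop n] with m hm
    obtain ⟨j, rfl⟩ := Nat.exists_eq_add_of_le hm
    rw [Finset.sum_range_add, Finset.sum_range_add]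
    have e1 : ∑ k ∈ Finset.range n, a k * (ε k * ξ k ω) =
        - ∑ k ∈ Finset.range n, a k * ξ k ω := by
      rw [← Finset.sum_neg_distrib]
      exact Finset.sum_congr rfl fun k hk => by simp [ε, Finset.mem_range.1 hk]
    have e2 : ∑ k ∈ Finset.range j, a (n + k) * (ε (n + k) * ξ (n + k) ω) =
        ∑ k ∈ Finset.range j, a (n + k) * ξ (n + k) ω :=
      Finset.sum_congr rfl fun k _ => by simp [ε]
    rw [e1, e2]
    ring
  have hms : MeasurableSet {x : ℝ | |x| ≤ R} := measurableSet_le (by fun_prop) (by fun_prop)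
  have hR' : ∀ᵐ ω ∂P, |Y' ω| ≤ R := by
    rw [← ae_map_iff hYm' hms, ← hlaw, ae_map_iff hYm hms]
    exact hR
  -- When the first n signs all equal 1, Y and Y' differ by 2 ∑ a_k > 2R, which is impossible if
  -- both lie in [-R, R].
  have hpos : 0 < P (⋂ k ∈ Finset.range n, ξ k ⁻¹' {1}) := by
    rw [hξ.indep.measure_inter_preimage_eq_mul (Finset.range n) (sets := fun _ => {1})
      fun _ _ => measurableSet_singleton _]
    refine pos_iff_ne_zero.2 (Finset.prod_ne_zero_iff.2 fun k _ => ?_)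
    have := hξ.prob_one k
    simp only [Set.preimage, Set.mem_singleton_iff, this]
    simp
  obtain ⟨ω, hω, h1, h2⟩ := ((frequently_ae_mem_iff.2 hpos.ne').and_eventually
    (hR.and hR')).exists
  have hsum : ∑ k ∈ Finset.range n, a k * ξ k ω = ∑ k ∈ Finset.range n, a k := by
    refine Finset.sum_congr rfl fun k hk => ?_
    have h := Set.mem_iInter₂.1 hω k hk
    simp only [Set.mem_preimage, Set.mem_singleton_iff] at h
    rw [h, mul_one]
  simp only [Y', hsum] at h2
  have := abs_le.1 h1
  have := abs_le.1 h2
  linarith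

end IsSignSequence

/-! ### From an integrable characteristic function to a bounded density -/

/-- A Gaussian smoothing inequality: a probability measure with integrable characteristic
function gives each interval at most a multiple of its length. -/
lemma measureReal_closedBall_le_of_integrable_charFun {μ : Measure ℝ} [IsProbabilityMeasure μ]
    (hμ : Integrable (charFun μ)) (x : ℝ) {r : ℝ} (hr : 0 < r) :
    μ.real (Metric.closedBall x r) ≤ r * (Real.exp (1 / 2) * ∫ t, ‖charFun μ t‖) := by
  -- The variance r⁻² makes the Gaussian characteristic function at y - x equal to exp(-(y - x)² /
  -- (2r²)), a bump of width r around x. The Gaussian density itself is at most r.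
  set w : NNReal := ⟨(r⁻¹) ^ 2, by positivity⟩ with hw
  have hwr : (w : ℝ) = (r⁻¹) ^ 2 := rfl
  have hw0 : w ≠ 0 := by
    rw [← NNReal.coe_ne_zero, hwr]
    positivity
  let G := gaussianReal 0 w
  have hG (y : ℝ) : ((Real.exp (-(y - x) ^ 2 / (2 * r ^ 2)) : ℝ) : ℂ) =
      ∫ t, Complex.exp (t * y * Complex.I) * Complex.exp (-(t * x * Complex.I)) ∂G := by
    have h := charFun_gaussianReal (μ := 0) (v := w) (y - x)
    rw [charFun_apply_real] at h
    have e : ∀ t : ℝ, Complex.exp (t * y * Complex.I) * Complex.exp (-(t * x * Complex.I)) =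
        Complex.exp (((y - x : ℝ) : ℂ) * t * Complex.I) := fun t => by
      rw [← Complex.exp_add]
      push_cast
      ring_nf
    simp_rw [e]
    rw [h, show ((w : NNReal) : ℂ) = ((r⁻¹ ^ 2 : ℝ) : ℂ) from rfl, Complex.ofReal_exp]
    congr 1
    push_cast
    have : (r : ℂ) ≠ 0 := by exact_mod_cast hr.ne'
    field_simp
    ring
  have hF : Integrable (Function.uncurry fun y t : ℝ =>
      Complex.exp (t * y * Complex.I) * Complex.exp (-(t * x * Complex.I))) (μ.prod G) := by
    refine Integrable.of_bound (C := 1) (by fun_prop) (ae_of_all _ fun p => ?_)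
    simp only [Function.uncurry, norm_mul]
    rw [← Complex.ofReal_mul, Complex.norm_exp_ofReal_mul_I, ← neg_mul, ← Complex.ofReal_mul,
      ← Complex.ofReal_neg, Complex.norm_exp_ofReal_mul_I, mul_one]
  have hint : Integrable (fun y => Real.exp (-(y - x) ^ 2 / (2 * r ^ 2))) μ := by
    refine Integrable.of_bound (C := 1) (by fun_prop) (ae_of_all _ fun y => ?_)
    rw [Real.norm_eq_abs, Real.abs_exp, Real.exp_le_one_iff, neg_div]
    exact neg_nonpos.2 (by positivity)
  have key : ∫ y, Real.exp (-(y - x) ^ 2 / (2 * r ^ 2)) ∂μ ≤ r * ∫ t, ‖charFun μ t‖ := by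
    calc ∫ y, Real.exp (-(y - x) ^ 2 / (2 * r ^ 2)) ∂μ
        ≤ ‖((∫ y, Real.exp (-(y - x) ^ 2 / (2 * r ^ 2)) ∂μ : ℝ) : ℂ)‖ := by
          rw [Complex.norm_real]
          exact le_abs_self _
      _ = ‖∫ t, charFun μ t * Complex.exp (-(t * x * Complex.I)) ∂G‖ := by
          rw [← integral_complex_ofReal]
          simp_rw [hG]
          rw [integral_integral_swap hF]
          simp_rw [charFun_apply_real, integral_mul_const]
      _ = ‖∫ t, gaussianPDFReal 0 w t •
            (charFun μ t * Complex.exp (-(t * x * Complex.I)))‖ := by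
          rw [integral_gaussianReal_eq_integral_smul hw0]
      _ ≤ ∫ t, r * ‖charFun μ t‖ := by
          refine norm_integral_le_of_norm_le (hμ.norm.const_mul r) (ae_of_all _ fun t => ?_)
          rw [norm_smul, norm_mul, ← neg_mul, ← Complex.ofReal_mul, ← Complex.ofReal_neg,
            Complex.norm_exp_ofReal_mul_I, mul_one, Real.norm_eq_abs,
            abs_of_nonneg (gaussianPDFReal_nonneg _ _ _)]
          refine mul_le_mul_of_nonneg_right ?_ (norm_nonneg _)
          rw [gaussianPDFReal_def]
          have h1 : Real.exp (-(t - 0) ^ 2 / (2 * w)) ≤ 1 := by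
            rw [Real.exp_le_one_iff, neg_div]
            exact neg_nonpos.2 (by positivity)
          have h2 : (√(2 * Real.pi * w))⁻¹ ≤ r := by
            rw [hwr, inv_le_comm₀ (by positivity) hr]
            refine Real.le_sqrt_of_sq_le ?_
            nlinarith [Real.pi_gt_three, sq_nonneg r⁻¹]
          calc (√(2 * Real.pi * w))⁻¹ * Real.exp (-(t - 0) ^ 2 / (2 * w)) ≤ r * 1 := by gcongr
            _ = r := mul_one r
      _ = r * ∫ t, ‖charFun μ t‖ := integral_const_mul _ _
  calc μ.real (Metric.closedBall x r)
      = ∫ y, (Metric.closedBall x r).indicator (fun _ => (1 : ℝ)) y ∂μ := by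
        rw [integral_indicator_const _ Metric.isClosed_closedBall.measurableSet]
        simp
    -- The bump is at least exp(-1/2) on the ball, whence the factor exp(1/2).
    _ ≤ ∫ y, Real.exp (1 / 2) * Real.exp (-(y - x) ^ 2 / (2 * r ^ 2)) ∂μ := by
        refine integral_mono ((integrable_const _).indicator
          Metric.isClosed_closedBall.measurableSet) (hint.const_mul _) fun y => ?_
        by_cases hy : y ∈ Metric.closedBall x r
        · simp only [Set.indicator_of_mem hy]
          rw [← Real.exp_add, Real.one_le_exp_iff]
          have h : (y - x) ^ 2 ≤ r ^ 2 := by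
            rw [Metric.mem_closedBall, Real.dist_eq] at hy
            exact sq_le_sq' (abs_le.1 hy).1 (abs_le.1 hy).2
          have : (y - x) ^ 2 / (2 * r ^ 2) ≤ 1 / 2 := by
            rw [div_le_div_iff₀ (by positivity) two_pos]
            linarith
          rw [neg_div]
          linarith
        · simp only [Set.indicator_of_notMem hy]
          positivity
    _ ≤ r * (Real.exp (1 / 2) * ∫ t, ‖charFun μ t‖) := by
        rw [integral_const_mul]
        nlinarith [Real.exp_pos (1 / 2), mul_le_mul_of_nonneg_left key (Real.exp_pos (1 / 2)).le]

/-- The estimate on balls passes to all sets through the Besicovitch Vitali family. -/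
lemma exists_le_smul_volume_of_integrable_charFun {μ : Measure ℝ} [IsProbabilityMeasure μ]
    (hμ : Integrable (charFun μ)) : ∃ C : NNReal, μ ≤ (C : ENNReal) • volume := by
  set D : ℝ := Real.exp (1 / 2) * ∫ t, ‖charFun μ t‖
  have hD : 0 ≤ D := mul_nonneg (Real.exp_pos _).le (integral_nonneg fun _ => norm_nonneg _)
  refine ⟨D.toNNReal, Measure.le_iff.2 fun s _ => ?_⟩
  have : IsLocallyFiniteMeasure ((D.toNNReal : ENNReal) • (volume : Measure ℝ)) := by
    rw [← ENNReal.smul_def]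
    infer_instance
  refine (Besicovitch.vitaliFamily μ).measure_le_of_frequently_le _
    Measure.AbsolutelyContinuous.rfl s fun x _ => ?_
  refine (Besicovitch.tendsto_filterAt μ x).frequently (Eventually.frequently ?_)
  filter_upwards [self_mem_nhdsWithin] with r hr
  have hr : 0 < r := hr
  have h := measureReal_closedBall_le_of_integrable_charFun hμ x hr
  rw [Measure.smul_apply, Real.volume_closedBall, smul_eq_mul, ← ofReal_measureReal]
  change _ ≤ ENNReal.ofReal D * _
  rw [← ENNReal.ofReal_mul hD]
  exact ENNReal.ofReal_le_ofReal (h.trans (by nlinarith))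

/-- A symmetric probability measure with integrable characteristic function has a symmetric,
bounded, square-integrable density. -/
lemma exists_symmetric_bounded_density {μ : Measure ℝ} [IsProbabilityMeasure μ]
    (hμ : Integrable (charFun μ)) (hsymm : μ.map (fun x => -x) = μ) :
    ∃ f : ℝ → ℝ, Measurable f ∧ (∀ x, 0 ≤ f x) ∧
      μ = volume.withDensity (fun x => ENNReal.ofReal (f x)) ∧
      (∀ x, f (-x) = f x) ∧ (∃ C : ℝ, ∀ x, f x ≤ C) ∧ MemLp f 2 volume := by
  obtain ⟨C, hC⟩ := exists_le_smul_volume_of_integrable_charFun hμ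
  have hac : μ ≪ volume := (Measure.absolutelyContinuous_of_le hC).trans
    Measure.smul_absolutelyContinuous
  have hd : volume.withDensity (μ.rnDeriv volume) = μ := Measure.withDensity_rnDeriv_eq _ _ hac
  have hle : μ.rnDeriv volume ≤ᵐ[volume] fun _ => (C : ENNReal) := by
    refine ae_le_of_forall_setLIntegral_le_of_sigmaFinite (Measure.measurable_rnDeriv _ _)
      fun s hs _ => ?_
    rw [← withDensity_apply _ hs, hd, setLIntegral_const]
    exact hC s
  -- Truncating at C makes the almost everywhere bound hold at every point.
  let g : ℝ → ℝ := fun x => min (μ.rnDeriv volume x).toReal C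
  have hgm : Measurable g := (Measure.measurable_rnDeriv _ _).ennreal_toReal.min measurable_const
  have hg0 (x : ℝ) : 0 ≤ g x := le_min ENNReal.toReal_nonneg C.2
  have hgC (x : ℝ) : g x ≤ C := min_le_right _ _
  have hg : volume.withDensity (fun x => ENNReal.ofReal (g x)) = μ := by
    rw [← hd]
    refine withDensity_congr_ae ?_
    filter_upwards [hle] with x hx
    have hfin : μ.rnDeriv volume x ≠ ⊤ := (hx.trans_lt ENNReal.coe_lt_top).ne
    have hmin : g x = (μ.rnDeriv volume x).toReal :=
      min_eq_left (by simpa using ENNReal.toReal_mono ENNReal.coe_ne_top hx)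
    rw [hmin, ENNReal.ofReal_toReal hfin]
  have hg' : volume.withDensity (fun x => ENNReal.ofReal (g (-x))) = μ := by
    ext s hs
    rw [withDensity_apply _ hs, ← hsymm, Measure.map_apply measurable_neg hs, ← hg,
      withDensity_apply _ (measurable_neg hs)]
    have h := (Measure.measurePreserving_neg (volume : Measure ℝ)).setLIntegral_comp_preimage hs
      (f := fun x => ENNReal.ofReal (g (-x))) (by fun_prop)
    simpa using h.symm
  -- Both g and its reflection are densities of μ; their average is symmetric at every point.
  let f : ℝ → ℝ := fun x => 1 / 2 * g x + 1 / 2 * g (-x)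
  have hfm : Measurable f := by fun_prop
  have hf0 (x : ℝ) : 0 ≤ f x := by
    have := hg0 x
    have := hg0 (-x)
    positivity
  have hfC (x : ℝ) : f x ≤ C := by
    have := hgC x
    have := hgC (-x)
    simp only [f]
    linarith
  have hf : μ = volume.withDensity (fun x => ENNReal.ofReal (f x)) := by
    have e : (fun x => ENNReal.ofReal (f x)) =
        ENNReal.ofReal (1 / 2) • (fun x => ENNReal.ofReal (g x)) +
          ENNReal.ofReal (1 / 2) • (fun x => ENNReal.ofReal (g (-x))) := by
      ext x
      simp only [f, Pi.add_apply, Pi.smul_apply, smul_eq_mul]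
      rw [ENNReal.ofReal_add (mul_nonneg (by norm_num) (hg0 _))
        (mul_nonneg (by norm_num) (hg0 _)), ENNReal.ofReal_mul (by norm_num),
        ENNReal.ofReal_mul (by norm_num)]
    rw [e, withDensity_add_left (by fun_prop), withDensity_smul _ (by fun_prop),
      withDensity_smul _ (by fun_prop), hg, hg', ← add_smul, ← ENNReal.ofReal_add (by norm_num)
      (by norm_num)]
    norm_num
  have hfi : Integrable f volume := by
    refine ⟨hfm.aestronglyMeasurable, ?_⟩
    rw [hasFiniteIntegral_iff_ofReal (ae_of_all _ hf0)]
    have h := measure_lt_top μ Set.univ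
    rwa [hf, withDensity_apply _ MeasurableSet.univ, Measure.restrict_univ] at h
  refine ⟨f, hfm, hf0, hf, fun x => by simp [f, add_comm], ⟨C, hfC⟩, ?_⟩
  rw [memLp_two_iff_integrable_sq hfm.aestronglyMeasurable]
  refine (hfi.const_mul (C : ℝ)).mono' (by fun_prop) (ae_of_all _ fun x => ?_)
  rw [Real.norm_eq_abs, abs_of_nonneg (sq_nonneg _), sq]
  exact mul_le_mul_of_nonneg_right (hfC x) (hf0 x)

/-! ### Size of the coefficients ρ_h(k) -/

/-- Mean value form of a second difference of a real power. -/
lemma exists_rho_eq {h : ℝ} (hh : 1 / 2 < h) {k : ℕ} (hk : 1 ≤ k) :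
    ∃ d : ℝ, (k : ℝ) - 1 < d ∧ d < k + 1 ∧
      rho h k = h * (2 * h - 1) * d ^ (2 * h - 2) := by
  have hk' : (1 : ℝ) ≤ k := by exact_mod_cast hk
  have hd (p : ℝ) {x : ℝ} (hx : 0 < x) : HasDerivAt (fun y : ℝ => y ^ p) (p * x ^ (p - 1)) x :=
    Real.hasDerivAt_rpow_const (Or.inl hx.ne')
  have hcont {p : ℝ} (hp : 0 < p) : Continuous fun y : ℝ => y ^ p :=
    Real.continuous_rpow_const hp.le
  -- First the difference y^(2h) - (y - 1)^(2h) on [k, k + 1], then y^(2h - 1) on [c - 1, c].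
  -- Derivatives are taken only at interior points, so k = 1 causes no trouble at the origin.
  obtain ⟨c, hc, hc'⟩ := exists_hasDerivAt_eq_slope
    (fun y : ℝ => y ^ (2 * h) - (y - 1) ^ (2 * h))
    (fun y : ℝ => 2 * h * y ^ (2 * h - 1) - 2 * h * (y - 1) ^ (2 * h - 1))
    (lt_add_one (k : ℝ))
    ((hcont (by linarith)).sub
      ((hcont (by linarith)).comp (continuous_id.sub continuous_const))).continuousOn
    (fun y hy => (hd _ (by linarith [hy.1])).sub
      ((hd (2 * h) (x := y - 1) (by linarith [hy.1])).comp_sub_const y 1))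
  obtain ⟨d, hd1, hd'⟩ := exists_hasDerivAt_eq_slope
    (fun y : ℝ => y ^ (2 * h - 1)) (fun y : ℝ => (2 * h - 1) * y ^ (2 * h - 1 - 1))
    (show c - 1 < c by linarith) (hcont (by linarith)).continuousOn
    (fun y hy => hd _ (by linarith [hy.1, hc.1]))
  refine ⟨d, by linarith [hd1.1, hc.1], by linarith [hd1.2, hc.2], ?_⟩
  rw [show 2 * h - 1 - 1 = 2 * h - 2 by ring, sub_sub_cancel, div_one] at hd'
  rw [add_sub_cancel_left, div_one, add_sub_cancel_right] at hc'
  rw [rho, mul_assoc, hd']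
  linear_combination (-1 / 2 : ℝ) * hc'

/-- The intermediate point for index k + 1 lies in (k, k + 2) and the power is decreasing: the left
end gives this bound, the right end the one in `le_rho_succ`. -/
lemma rho_succ_le {h : ℝ} (hh : 1 / 2 < h) (hh' : h < 1) {k : ℕ} (hk : 1 ≤ k) :
    rho h (k + 1) ≤ h * (2 * h - 1) * (k : ℝ) ^ (-(2 - 2 * h)) := by
  have hk' : (1 : ℝ) ≤ k := by exact_mod_cast hk
  obtain ⟨d, hd, -, e⟩ := exists_rho_eq hh (Nat.le_add_left 1 k)
  push_cast at hd
  rw [e, neg_sub]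
  exact mul_le_mul_of_nonneg_left (Real.rpow_le_rpow_of_nonpos (by linarith) (by linarith)
    (by linarith)) (mul_nonneg (by linarith) (by linarith))

lemma le_rho_succ {h : ℝ} (hh : 1 / 2 < h) (hh' : h < 1) (k : ℕ) :
    h * (2 * h - 1) * ((k : ℝ) + 2) ^ (-(2 - 2 * h)) ≤ rho h (k + 1) := by
  obtain ⟨d, hd, hd', e⟩ := exists_rho_eq hh (Nat.le_add_left 1 k)
  push_cast at hd hd'
  have : (0 : ℝ) ≤ k := k.cast_nonneg
  rw [e, neg_sub]
  exact mul_le_mul_of_nonneg_left (Real.rpow_le_rpow_of_nonpos (by linarith) (by linarith)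
    (by linarith)) (mul_nonneg (by linarith) (by linarith))

lemma rho_succ_pos {h : ℝ} (hh : 1 / 2 < h) (hh' : h < 1) (k : ℕ) : 0 < rho h (k + 1) :=
  lt_of_lt_of_le (mul_pos (mul_pos (by linarith) (by linarith))
    (Real.rpow_pos_of_pos (by positivity) _)) (le_rho_succ hh hh' k)

lemma summable_rho_sq {h : ℝ} (hh : 1 / 2 < h) (hh' : h < 3 / 4) :
    Summable fun k => rho h (k + 1) ^ 2 := by
  -- The first term is dropped because the upper bound needs k ≥ 1. The comparison series has
  -- exponent 4 - 4h > 1, which is where h < 3/4 enters.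
  rw [← summable_nat_add_iff 1]
  have hs : Summable fun k : ℕ =>
      (h * (2 * h - 1)) ^ 2 * ((k + 1 : ℕ) : ℝ) ^ (-(2 - 2 * h) * 2) :=
    ((summable_nat_add_iff 1).2 (Real.summable_nat_rpow.2 (by linarith))).mul_left _
  refine hs.of_nonneg_of_le (fun _ => sq_nonneg _) fun k => ?_
  have hp := rho_succ_pos hh (by linarith) (k + 1)
  have hle := rho_succ_le hh (by linarith) (Nat.le_add_left 1 k)
  calc rho h (k + 1 + 1) ^ 2
      ≤ (h * (2 * h - 1) * ((k + 1 : ℕ) : ℝ) ^ (-(2 - 2 * h))) ^ 2 := by gcongr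
    _ = _ := by
        rw [mul_pow, ← Real.rpow_natCast (((k + 1 : ℕ) : ℝ) ^ (-(2 - 2 * h))) 2,
          ← Real.rpow_mul (by positivity)]
        norm_num

lemma tendsto_sum_rho {h : ℝ} (hh : 1 / 2 < h) (hh' : h < 1) :
    Tendsto (fun n => ∑ k ∈ Finset.range n, rho h (k + 1)) atTop atTop := by
  rw [← not_summable_iff_tendsto_nat_atTop_of_nonneg fun k => (rho_succ_pos hh hh' k).le]
  intro hs
  have h1 : Summable fun k : ℕ => h * (2 * h - 1) * ((k : ℝ) + 2) ^ (-(2 - 2 * h)) :=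
    hs.of_nonneg_of_le (fun k => mul_nonneg (mul_nonneg (by linarith) (by linarith))
      (by positivity)) fun k => le_rho_succ hh hh' k
  have hc : h * (2 * h - 1) ≠ 0 := (mul_pos (by linarith) (by linarith)).ne'
  rw [summable_mul_left_iff hc] at h1
  have h2 : Summable fun k : ℕ => ((k + 2 : ℕ) : ℝ) ^ (-(2 - 2 * h)) := by exact_mod_cast h1
  have := Real.summable_nat_rpow.1 ((summable_nat_add_iff 2).1 h2)
  linarith

/-! ### Decay of the cosine product and integrability -/

lemma norm_le_prod_of_hasProd {f : ℕ → ℂ} {a : ℂ} (hf : HasProd f a) (h1 : ∀ k, ‖f k‖ ≤ 1)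
    (s : Finset ℕ) : ‖a‖ ≤ ∏ k ∈ s, ‖f k‖ := by
  refine le_of_tendsto (f := fun t : Finset ℕ => ‖∏ k ∈ t, f k‖) (x := atTop)
    (Tendsto.norm hf) ?_
  filter_upwards [eventually_ge_atTop s] with t ht
  rw [norm_prod, ← Finset.prod_sdiff ht]
  exact mul_le_of_le_one_left (Finset.prod_nonneg fun _ _ => norm_nonneg _)
    (Finset.prod_le_one (fun _ _ => norm_nonneg _) fun k _ => h1 k)

/-- Superexponential decay of the infinite product of cosines. -/
lemma exists_decay {h : ℝ} (hh : 1 / 2 < h) (hh' : h < 1) :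
    ∃ θ : ℝ, 0 < θ ∧ ∃ u₀ : ℝ, 0 < u₀ ∧ ∀ w : ℝ, u₀ ≤ w → ∀ a : ℂ,
      HasProd (fun k => (Real.cos (w * rho h (k + 1)) : ℂ)) a →
      ‖a‖ ≤ Real.exp (-θ * w ^ (1 / (2 - 2 * h))) := by
  set K := h * (2 * h - 1) with hK
  set α := 2 - 2 * h with hα
  have hK0 : 0 < K := mul_pos (by linarith) (by linarith)
  have hα0 : 0 < α := by linarith
  have hα1 : α < 1 := by linarith
  -- From cos y ≤ 1 - (2/π²) y² ≤ exp(-δ) for 1/6 ≤ y ≤ 1.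
  set δ : ℝ := 2 / Real.pi ^ 2 * (1 / 6) ^ 2 with hδ
  have hδ0 : 0 < δ := by positivity
  refine ⟨δ * K ^ (1 / α), by positivity, 1 / K, by positivity, fun w hw a ha => ?_⟩
  have hw0 : 0 < w := lt_of_lt_of_le (by positivity) hw
  have hKw : 1 ≤ K * w := by rwa [div_le_iff₀' hK0] at hw
  -- Here x solves K w x^(-α) = 1, so w ρ_h(k + 1) has order 1 for k between N = ⌈x⌉ and 2N. The
  -- threshold 1/K ensures x ≥ 1.
  set x := (K * w) ^ (1 / α) with hx
  have hx1 : 1 ≤ x := Real.one_le_rpow hKw (by positivity)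
  have hxα : x ^ α = K * w := by
    rw [hx, ← Real.rpow_mul (by positivity), one_div, inv_mul_cancel₀ hα0.ne', Real.rpow_one]
  set N := ⌈x⌉₊
  have hxN : x ≤ N := Nat.le_ceil x
  have hNx : (N : ℝ) ≤ 2 * x := by linarith [Nat.ceil_lt_add_one (zero_le_one.trans hx1)]
  have hN1 : 1 ≤ N := by exact_mod_cast hx1.trans hxN
  have hN1' : (1 : ℝ) ≤ N := by exact_mod_cast hN1
  have hcos : ∀ k ∈ Finset.Ico N (2 * N),
      ‖(Real.cos (w * rho h (k + 1)) : ℂ)‖ ≤ Real.exp (-δ) := by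
    intro k hk
    rw [Finset.mem_Ico] at hk
    have hNk : (N : ℝ) ≤ k := by exact_mod_cast hk.1
    have hkN : (k : ℝ) + 1 ≤ 2 * N := by exact_mod_cast hk.2
    have hup : w * rho h (k + 1) ≤ 1 := by
      calc w * rho h (k + 1) ≤ w * (K * (k : ℝ) ^ (-α)) := by
            gcongr
            exact rho_succ_le hh hh' (hN1.trans hk.1)
        _ ≤ w * (K * x ^ (-α)) := by
            gcongr w * (K * ?_)
            exact Real.rpow_le_rpow_of_nonpos (by linarith) (hxN.trans hNk) (by linarith)
        _ = 1 := by
            rw [Real.rpow_neg (by linarith), hxα]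
            field_simp
    -- In this range k + 2 ≤ 2N + 1 ≤ 4x + 1 ≤ 6x, and 6^α ≤ 6 since α < 1.
    have hlo : 1 / 6 ≤ w * rho h (k + 1) := by
      calc (1 / 6 : ℝ) ≤ w * (K * (6 * x) ^ (-α)) := by
            rw [Real.rpow_neg (by linarith), Real.mul_rpow (by norm_num) (by linarith), hxα]
            have h6 : (6 : ℝ) ^ α ≤ 6 := by
              simpa using Real.rpow_le_rpow_of_exponent_le (x := 6) (by norm_num) hα1.le
            have h6' : (0 : ℝ) < 6 ^ α := by positivity
            have e : w * (K * (6 ^ α * (K * w))⁻¹) = 1 / 6 ^ α := by field_simp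
            rw [e]
            exact one_div_le_one_div_of_le h6' h6
        _ ≤ w * (K * ((k : ℝ) + 2) ^ (-α)) := by
            gcongr w * (K * ?_)
            exact Real.rpow_le_rpow_of_nonpos (by linarith) (by linarith) (by linarith)
        _ ≤ w * rho h (k + 1) := by
            gcongr
            exact le_rho_succ hh hh' k
    have hcp : 0 ≤ Real.cos (w * rho h (k + 1)) :=
      Real.cos_nonneg_of_neg_pi_div_two_le_of_le (by linarith [Real.pi_pos])
        (by linarith [Real.pi_gt_three])
    rw [Complex.norm_real, Real.norm_eq_abs, abs_of_nonneg hcp]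
    have hb := Real.cos_le_one_sub_mul_cos_sq (x := w * rho h (k + 1))
      (abs_le.2 ⟨by linarith [Real.pi_pos], by linarith [Real.pi_gt_three]⟩)
    have hsq : δ ≤ 2 / Real.pi ^ 2 * (w * rho h (k + 1)) ^ 2 := by
      rw [hδ]
      gcongr
    linarith [Real.add_one_le_exp (-δ)]
  calc ‖a‖ ≤ ∏ k ∈ Finset.Ico N (2 * N), ‖(Real.cos (w * rho h (k + 1)) : ℂ)‖ := by
        refine norm_le_prod_of_hasProd ha (fun k => ?_) _
        rw [Complex.norm_real]
        exact Real.abs_cos_le_one _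
    _ ≤ ∏ _k ∈ Finset.Ico N (2 * N), Real.exp (-δ) :=
        Finset.prod_le_prod (fun _ _ => norm_nonneg _) hcos
    _ = Real.exp (-δ * N) := by
        rw [Finset.prod_const, Nat.card_Ico, ← Real.exp_nat_mul, show 2 * N - N = N by omega,
          mul_comm]
    _ ≤ Real.exp (-(δ * K ^ (1 / α)) * w ^ (1 / α)) := by
        rw [Real.exp_le_exp, neg_mul, neg_mul, neg_le_neg_iff, mul_assoc,
          ← Real.mul_rpow hK0.le hw0.le]
        gcongr

lemma integrable_exp_neg_mul_abs_rpow {b p : ℝ} (hb : 0 < b) (hp : 0 < p) :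
    Integrable fun x : ℝ => Real.exp (-b * |x| ^ p) := by
  have h : IntegrableOn (fun x : ℝ => Real.exp (-b * |x| ^ p)) (Set.Ioi 0) := by
    refine (integrableOn_rpow_mul_exp_neg_mul_rpow (s := 0) (by norm_num) hp hb).congr_fun
      (fun x hx => ?_) measurableSet_Ioi
    simp only [Real.rpow_zero, one_mul]
    rw [abs_of_pos hx]
  rw [← integrableOn_univ, ← Set.Iic_union_Ioi (a := (0 : ℝ)), integrableOn_union,
    integrableOn_Iic_iff_integrableOn_Iio]
  rw [← neg_zero] at h
  exact ⟨by simpa only [abs_neg] using h.comp_neg_Iio, by simpa only [neg_zero] using h⟩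

lemma cH_pos {H : ℝ} (h₀ : 1 / 2 < H) (h₁ : H < 1) : 0 < cH H := by
  refine Real.sqrt_pos.2 (div_pos (mul_pos (by linarith) (Real.Gamma_pos_of_pos (by linarith)))
    (mul_pos (Real.Gamma_pos_of_pos (by linarith)) (Real.Gamma_pos_of_pos (by linarith))))

lemma gH_pos {σ H : ℝ} (hσ : 0 < σ) (h₀ : 1 / 2 < H) (h₁ : H < 1) : 0 < gH σ H :=
  div_pos (mul_pos hσ (cH_pos h₀ h₁)) (by linarith)

lemma partialY_eq_sum {Ω : Type*} (σ H : ℝ) (ξ : ℕ → Ω → ℝ) (n : ℕ) (ω : Ω) :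
    partialY σ H ξ n ω =
      ∑ k ∈ Finset.range n, 2 * gH σ H * rho (hOf H) (k + 1) * ξ k ω := by
  simp_rw [partialY, Finset.mul_sum, mul_assoc]

/-- A measurable function which is dominated by `exp (-θ (c |v|) ^ p)` for large `|v|` and by `1`
everywhere is integrable. -/
lemma integrable_of_le_exp_neg_rpow {φ : ℝ → ℂ} (hm : AEStronglyMeasurable φ volume)
    (h1 : ∀ v, ‖φ v‖ ≤ 1) {θ c p u₀ : ℝ} (hθ : 0 < θ) (hc : 0 < c) (hp : 0 < p)
    (hu : 0 < u₀)
    (h : ∀ v, u₀ ≤ c * |v| → ‖φ v‖ ≤ Real.exp (-θ * (c * |v|) ^ p)) : Integrable φ := by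
  -- The constant exp(θ u₀^p) lifts the majorant above 1 on the range c|v| ≤ u₀.
  refine ((integrable_exp_neg_mul_abs_rpow (b := θ * c ^ p) (by positivity) hp).const_mul
    (Real.exp (θ * u₀ ^ p))).mono' hm (ae_of_all _ fun v => ?_)
  rw [← Real.exp_add]
  have e : (c * |v|) ^ p = c ^ p * |v| ^ p := Real.mul_rpow hc.le (abs_nonneg v)
  rcases le_total u₀ (c * |v|) with hv | hv
  · refine (h v hv).trans (Real.exp_le_exp.2 ?_)
    rw [e]
    have : 0 ≤ θ * u₀ ^ p := by positivity
    linarith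
  · refine (h1 v).trans (Real.one_le_exp ?_)
    have : (c * |v|) ^ p ≤ u₀ ^ p := Real.rpow_le_rpow (by positivity) hv hp.le
    rw [e] at this
    nlinarith

end FracBinary

/-! ### The law of 𝒴_H -/

theorem mainTheorem6 (H : ℝ) (hH₀ : 1 / 2 < H) (hH₁ : H < 1) :
    ∃ θ : ℝ, 0 < θ ∧ ∃ u₀ : ℝ, ∀ (σ : ℝ), 0 < σ →
    ∀ (Ω : Type*) [MeasurableSpace Ω] (P : Measure Ω) [IsProbabilityMeasure P]
      (ξ : ℕ → Ω → ℝ), FracBinary.IsSignSequence P ξ →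
    -- the series defining `𝒴_H` converges almost surely, and `𝒴_H` is a random variable
    (∀ᵐ ω ∂P, Tendsto (fun n => FracBinary.partialY σ H ξ n ω) atTop
      (𝓝 (FracBinary.YH σ H ξ ω))) ∧
    AEMeasurable (FracBinary.YH σ H ξ) P ∧
    -- its law is absolutely continuous
    P.map (FracBinary.YH σ H ξ) ≪ volume ∧
    -- with a symmetric, bounded, square-integrable density without compact support
    (∃ f : ℝ → ℝ, Measurable f ∧ (∀ x, 0 ≤ f x) ∧
      P.map (FracBinary.YH σ H ξ) = volume.withDensity (fun x => ENNReal.ofReal (f x)) ∧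
      (∀ x, f (-x) = f x) ∧
      (∃ C : ℝ, ∀ x, f x ≤ C) ∧
      MemLp f 2 volume ∧
      ¬ ∃ K : Set ℝ, IsCompact K ∧ ∀ᵐ x ∂(volume : Measure ℝ), x ∉ K → f x = 0) ∧
    -- product formula for the characteristic function
    (∀ v : ℝ, HasProd
      (fun k : ℕ => ((Real.cos (2 * v * FracBinary.gH σ H *
        FracBinary.rho (FracBinary.hOf H) (k + 1)) : ℝ) : ℂ))
      (charFun (P.map (FracBinary.YH σ H ξ)) v)) ∧
    -- decay of the characteristic function, with an exponent `1 / (2 - 2h) > 1`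
    (∀ v : ℝ, u₀ ≤ 2 * FracBinary.gH σ H * |v| →
      ‖charFun (P.map (FracBinary.YH σ H ξ)) v‖ ≤
        Real.exp (-θ * (2 * FracBinary.gH σ H * |v|) ^ (1 / (2 - 2 * FracBinary.hOf H)))) := by
  have hh : 1 / 2 < FracBinary.hOf H := by
    rw [FracBinary.hOf]
    linarith
  have hh' : FracBinary.hOf H < 3 / 4 := by
    rw [FracBinary.hOf]
    linarith
  obtain ⟨θ, hθ, u₀, hu₀, hdecay⟩ := FracBinary.exists_decay hh (by linarith)
  refine ⟨θ, hθ, u₀, fun σ hσ Ω _ P _ ξ hξ => ?_⟩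
  have hg := FracBinary.gH_pos hσ hH₀ hH₁
  set g := FracBinary.gH σ H
  set a : ℕ → ℝ := fun k => 2 * g * FracBinary.rho (FracBinary.hOf H) (k + 1) with ha_def
  set Y := FracBinary.YH σ H ξ with hY_def
  have ha : Summable fun k => a k ^ 2 := by
    simpa only [ha_def, mul_pow] using
      (FracBinary.summable_rho_sq hh hh').mul_left (2 ^ 2 * g ^ 2)
  have hdiv : Tendsto (fun n => ∑ k ∈ Finset.range n, a k) atTop atTop := by
    simp_rw [ha_def, ← Finset.mul_sum]
    exact (FracBinary.tendsto_sum_rho hh (by linarith)).const_mul_atTop (by positivity)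
  have hY : ∀ᵐ ω ∂P, Tendsto (fun n => FracBinary.partialY σ H ξ n ω) atTop (𝓝 (Y ω)) := by
    filter_upwards [hξ.exists_ae_tendsto_sum ha] with ω hω
    refine tendsto_nhds_limUnder ?_
    simpa only [FracBinary.partialY_eq_sum] using hω
  have hYm : AEMeasurable Y P := by
    refine aemeasurable_of_tendsto_metrizable_ae atTop (fun n => ?_) hY
    exact ((Finset.measurable_sum _ fun k _ =>
      (hξ.measurable k).const_mul _).const_mul _).aemeasurable
  have hYs : ∀ᵐ ω ∂P, Tendsto (fun n => ∑ k ∈ Finset.range n, a k * ξ k ω) atTop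
      (𝓝 (Y ω)) := by
    simpa only [FracBinary.partialY_eq_sum] using hY
  have := Measure.isProbabilityMeasure_map hYm
  have hprod (v : ℝ) : HasProd (fun k : ℕ => ((Real.cos (2 * v * g *
      FracBinary.rho (FracBinary.hOf H) (k + 1)) : ℝ) : ℂ)) (charFun (P.map Y) v) := by
    have e (k : ℕ) : 2 * v * g * FracBinary.rho (FracBinary.hOf H) (k + 1) = v * a k := by
      rw [ha_def]
      ring
    simp_rw [e]
    exact hξ.hasProd_charFun ha hYm hYs v
  have hbound (v : ℝ) (hv : u₀ ≤ 2 * g * |v|) : ‖charFun (P.map Y) v‖ ≤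
      Real.exp (-θ * (2 * g * |v|) ^ (1 / (2 - 2 * FracBinary.hOf H))) := by
    refine hdecay _ hv _ ?_
    have e (k : ℕ) : Real.cos (2 * g * |v| * FracBinary.rho (FracBinary.hOf H) (k + 1)) =
        Real.cos (2 * v * g * FracBinary.rho (FracBinary.hOf H) (k + 1)) := by
      rcases abs_choice v with h | h
      · rw [h]
        ring_nf
      · rw [h, ← Real.cos_neg]
        ring_nf
    simpa only [e] using hprod v
  have hint : Integrable (charFun (P.map Y)) :=
    FracBinary.integrable_of_le_exp_neg_rpow stronglyMeasurable_charFun.aestronglyMeasurable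
      norm_charFun_le_one hθ (by positivity) (one_div_pos.2 (by linarith)) hu₀ hbound
  have hsymm : (P.map Y).map (fun x => -x) = P.map Y := by
    rw [AEMeasurable.map_map_of_aemeasurable measurable_neg.aemeasurable hYm]
    exact hξ.map_neg_eq ha hYm hYs
  obtain ⟨f, hfm, hf0, hf, hfs, hfC, hf2⟩ :=
    FracBinary.exists_symmetric_bounded_density hint hsymm
  refine ⟨hY, hYm, ?_, ⟨f, hfm, hf0, hf, hfs, hfC, hf2, ?_⟩, hprod, hbound⟩
  · rw [hf]
    exact withDensity_absolutelyContinuous _ _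
  -- A density vanishing outside a compact set would bound 𝒴_H almost surely.
  · rintro ⟨K, hK, hfK⟩
    obtain ⟨R, hR⟩ := hK.isBounded.subset_closedBall 0
    refine hξ.not_ae_abs_le ha hdiv hYm hYs R ?_
    rw [← ae_map_iff hYm (p := fun x => |x| ≤ R)
      (measurableSet_le (by fun_prop) (by fun_prop)), hf, ae_withDensity_iff (by fun_prop)]
    filter_upwards [hfK] with x hx hfx
    by_contra hxR
    refine hfx ?_
    rw [hx fun hxK => hxR (by simpa using hR hxK), ENNReal.ofReal_zero]
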